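/- Let $\mathcal H$ be a finite-dimensional complex Hilbert space, and let $\mathcal L'(s)$, $s\in\mathbb R$, be linear maps on the space of operators on $\mathcal H$, given near $s=0$ by a convergent power series $\mathcal L'(s)=\mathcal L+s\mathcal L_1+s^2\mathcal L_2+\cdots$, such that for all real $s$ in a neighbourhood of $0$ (of both signs) $\mathcal L'(s)$ generates a CPTP semigroup, i.e. $e^{t\mathcal L'(s)}$ is completely positive and trace preserving for all $t\ge 0$. Let $\omega\in\mathbb R$ and suppose that $\mathrm i\omega$ is an eigenvalue of $\mathcal L=\mathcal L'(0)$, of algebraic multiplicity $m$. Say that a function $\lambda$ has a *stable expansion* if $$\lambda(s)=\mathrm i\omega+\mathrm i\lambda_1 s+\lambda_2 s^{1+1/p}+o\bigl(|s|^{1+1/p}\bigr)$$ for some $\lambda_1\in\mathbb R$, some $\lambda_2\in\mathbb C$ with $\operatorname{Re}\lambda_2\le 0$ and some integer $p\ge 1$ (the power takes its principal value when $s<0$). Then: 1. There are $r>0$ and functions $\lambda^{(1)},\dots,\lambda^{(m)}:\mathbb R\to\mathbb C$ such that for all real $s$ sufficiently near $0$ the eigenvalues of $\mathcal L'(s)$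 in the disc $|z-\mathrm i\omega|<r$, repeated according to algebraic multiplicity, are exactly $\lambda^{(1)}(s),\dots,\lambda^{(m)}(s)$, and each $\lambda^{(j)}$ has a stable expansion as $s\to0$ (two-sided). 2. Every continuous function $\lambda$ on an interval $[0,\delta)$, $\delta>0$, such that $\lambda(0)=\mathrm i\omega$ and $\lambda(s)$ is an eigenvalue of $\mathcal L'(s)$ for each $s\in[0,\delta)$, has a stable expansion as $s\to0^+$. -/

import Mathlib

open Filter Topology Asymptotics

noncomputable section

/-- The bounded operators on `H`. -/
abbrev Op (H : Type*) [NormedAddCommGroup H] [InnerProductSpace ℂ H] : Type _ := H →L[ℂ] H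

/-- The superoperators on `H`: linear maps from operators on `H` to operators on `H`. -/
abbrev SuperOp (H : Type*) [NormedAddCommGroup H] [InnerProductSpace ℂ H] : Type _ :=
  Op H →L[ℂ] Op H

/-- `T` is a quantum channel: completely positive (for the C*-algebra of operators on `H` with the
Loewner order) and trace preserving. -/
structure IsCPTP {H : Type*} [NormedAddCommGroup H] [InnerProductSpace ℂ H]
    [FiniteDimensional ℂ H] [CompleteSpace H] (T : SuperOp H) : Prop where
  completelyPositive : ∃ φ : CompletelyPositiveMap (Op H) (Op H), ∀ X : Op H, φ X = T X
  tracePreserving : ∀ X : Op H,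
    LinearMap.trace ℂ H (T X : H →ₗ[ℂ] H) = LinearMap.trace ℂ H (X : H →ₗ[ℂ] H)

/-- `L` generates a CPTP semigroup: `exp (t L)` is a quantum channel for all `t ≥ 0`. -/
def IsCPTPGenerator {H : Type*} [NormedAddCommGroup H] [InnerProductSpace ℂ H]
    [FiniteDimensional ℂ H] [CompleteSpace H] (L : SuperOp H) : Prop :=
  ∀ t : ℝ, 0 ≤ t → IsCPTP (NormedSpace.exp (t • L))

/-- The characteristic polynomial of a superoperator. -/
def SuperOp.charpoly {H : Type*} [NormedAddCommGroup H] [InnerProductSpace ℂ H]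
    [FiniteDimensional ℂ H] (L : SuperOp H) : Polynomial ℂ :=
  LinearMap.charpoly (L : Op H →ₗ[ℂ] Op H)

open Classical in
/-- The eigenvalues of `L` in the open disc of radius `r` about `z`, repeated according to their
algebraic multiplicities. -/
def SuperOp.eigenvaluesNear {H : Type*} [NormedAddCommGroup H] [InnerProductSpace ℂ H]
    [FiniteDimensional ℂ H] (L : SuperOp H) (z : ℂ) (r : ℝ) : Multiset ℂ :=
  (SuperOp.charpoly L).roots.filter fun μ => μ ∈ Metric.ball z r

/-- Along the filter `l` (of real `s` tending to `0`),
`ev s = i ω + i a s + b s ^ (1 + 1 / p) + o(|s| ^ (1 + 1 / p))`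
for some real `a`, some complex `b` with `Re b ≤ 0` and some integer `p ≥ 1`.
The complex power takes its principal value. -/
def HasStableExpansion (l : Filter ℝ) (ω : ℝ) (ev : ℝ → ℂ) : Prop :=
  ∃ (a : ℝ) (b : ℂ) (p : ℕ), 1 ≤ p ∧ b.re ≤ 0 ∧
    (fun s : ℝ => ev s - (Complex.I * ω + Complex.I * a * s
        + b * (s : ℂ) ^ ((1 : ℂ) + 1 / (p : ℂ))))
      =o[l] fun s : ℝ => |s| ^ ((1 : ℝ) + 1 / (p : ℝ))

end

/-! Channels are pointwise bounded: a positive operator is dominated in norm by its trace, and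
positive operators span. Boundedness of `exp (t L)` for `t ≥ 0` puts the spectrum of a generator in
the closed left half plane and makes its eigenvalues on the imaginary axis semisimple.

Semisimplicity splits `L' 0 - iω` as zero plus an invertible block, so the characteristic polynomial
of `L' s` at `iω + s X` equals `s ^ m * Q s`, where `Q s` has coefficients differentiable at `0` and
`Q 0` has degree exactly `m` (`SuperOp.exists_reduced_charpoly`). The roots of `Q 0` are the
possible slopes of the eigenvalues. A slope `y` forces `s * y.re ≤ 0` for both signs of `s`, so
every slope is purely imaginary.

Near a root `y` of `Q 0` of multiplicity `p`, substitute `y + s ^ (1 / p) * w` and divide by `s`.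
The limit is a binomial `c w ^ p + d` with `c ≠ 0`, and continuity of roots gives `p` branches whose
next coefficients are the roots of the binomial (`DifferentiableCoeffs.exists_branches`). No full
Puiseux series is needed. The sign of the real part for `s > 0` gives `Re b ≤ 0`.

These branches number `m` in all, and a small disc contains exactly `m` eigenvalues, so they exhaust
the eigenvalues there. A continuous eigenvalue follows these branches; by connectedness it cannot
jump between different slopes, nor then between different next coefficients. -/

theorem Multiset.eventually_forall_mem {α β : Type*} {l : Filter α} {M : Multiset β}
    {q : β → α → Prop} (h : ∀ x ∈ M, ∀ᶠ s in l, q x s) : ∀ᶠ s in l, ∀ x ∈ M, q x s := by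
  classical
  have h2 : ∀ᶠ s in l, ∀ x ∈ M.toFinset, q x s :=
    (Finset.eventually_all _).2 fun x hx => h x (Multiset.mem_toFinset.1 hx)
  filter_upwards [h2] with s hs x hx using hs x (Multiset.mem_toFinset.2 hx)

/-! ### Continuity of roots with multiplicity -/

open Polynomial in
/-- If all roots of `p` are at distance at least `ε` from `b`, then `p b` is not much smaller than
any other value of `p`. -/
theorem Polynomial.norm_eval_le_of_forall_roots_le_dist (p : ℂ[X]) {b : ℂ} {ε : ℝ} (hε : 0 < ε)
    (h : ∀ x ∈ p.roots, ε ≤ dist x b) (y : ℂ) :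
    ‖p.eval y‖ ≤ (1 + ‖y - b‖ / ε) ^ p.natDegree * ‖p.eval b‖ := by
  have hs : p.Splits := IsAlgClosed.splits p
  -- Each factor satisfies `‖y - x‖ ≤ ‖y - b‖ + ‖b - x‖`, and `ε ≤ ‖b - x‖` absorbs the first term;
  -- the bounds multiply over the roots.
  have key : ∀ M : Multiset ℂ, (∀ x ∈ M, ε ≤ dist x b) →
      (M.map fun x => ‖y - x‖).prod
        ≤ (1 + ‖y - b‖ / ε) ^ M.card * (M.map fun x => ‖b - x‖).prod := by
    intro M
    induction M using Multiset.induction_on with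
    | empty => simp
    | cons x M ih =>
      intro hM
      have h1 : ‖y - x‖ ≤ (1 + ‖y - b‖ / ε) * ‖b - x‖ := by
        have hx : ε ≤ ‖b - x‖ := by
          have := hM x (by simp)
          rwa [dist_comm, dist_eq_norm] at this
        calc ‖y - x‖ ≤ ‖y - b‖ + ‖b - x‖ := norm_sub_le_norm_sub_add_norm_sub y b x
          _ = ‖y - b‖ / ε * ε + ‖b - x‖ := by field_simp
          _ ≤ ‖y - b‖ / ε * ‖b - x‖ + ‖b - x‖ := by gcongr
          _ = _ := by ring
      have h2 := ih fun z hz => hM z (by simp [hz])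
      have h3 : 0 ≤ (M.map fun x => ‖y - x‖).prod :=
        Multiset.prod_nonneg (by simp +contextual)
      simp only [Multiset.map_cons, Multiset.prod_cons, Multiset.card_cons, pow_succ]
      calc _ ≤ ((1 + ‖y - b‖ / ε) * ‖b - x‖) *
            ((1 + ‖y - b‖ / ε) ^ M.card * (M.map fun x => ‖b - x‖).prod) :=
            mul_le_mul h1 h2 h3 (by positivity)
        _ = _ := by ring
  have hev : ∀ z, ‖p.eval z‖ = ‖p.leadingCoeff‖ * (p.roots.map fun x => ‖z - x‖).prod := by
    intro z
    conv_lhs => rw [← C_leadingCoeff_mul_prod_multiset_X_sub_C hs.natDegree_eq_card_roots.symm]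
    rw [eval_mul, eval_C, norm_mul, eval_multiset_prod, Multiset.map_map]
    congr 1
    simpa using (Multiset.prod_hom (p.roots.map fun x => z - x) (normHom (α := ℂ))).symm
  rw [hev, hev, hs.natDegree_eq_card_roots]
  have := mul_le_mul_of_nonneg_left (key p.roots h) (norm_nonneg p.leadingCoeff)
  linarith

open Polynomial in
theorem Polynomial.tendsto_eval_of_tendsto_coeff {α : Type*} {l : Filter α} {N : ℕ}
    {P : α → ℂ[X]} {P₀ : ℂ[X]} (hdeg : ∀ᶠ s in l, (P s).natDegree ≤ N) (hdeg₀ : P₀.natDegree ≤ N)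
    (hP : ∀ k, Tendsto (fun s => (P s).coeff k) l (𝓝 (P₀.coeff k))) (y : ℂ) :
    Tendsto (fun s => (P s).eval y) l (𝓝 (P₀.eval y)) := by
  rw [eval_eq_sum_range' (Nat.lt_succ_of_le hdeg₀)]
  refine (tendsto_finsetSum (Finset.range N.succ) fun k _ =>
    (hP k).mul_const (y ^ k)).congr' ?_
  filter_upwards [hdeg] with s hs
  rw [eval_eq_sum_range' (Nat.lt_succ_of_le hs)]

open Polynomial in
theorem Polynomial.natDegree_le_of_tendsto_coeff {α : Type*} {l : Filter α} [l.NeBot] {N : ℕ}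
    {P : α → ℂ[X]} {P₀ : ℂ[X]} (hdeg : ∀ᶠ s in l, (P s).natDegree ≤ N)
    (hP : ∀ k, Tendsto (fun s => (P s).coeff k) l (𝓝 (P₀.coeff k))) : P₀.natDegree ≤ N := by
  refine natDegree_le_iff_coeff_eq_zero.2 fun k hk => ?_
  refine tendsto_nhds_unique (hP k) (tendsto_const_nhds.congr' ?_)
  filter_upwards [hdeg] with s hs
  exact (coeff_eq_zero_of_natDegree_lt (hs.trans_lt hk)).symm

open Polynomial in
/-- A root of the limit polynomial is a limit of roots. -/
theorem Polynomial.exists_root_tendsto {α : Type*} {l : Filter α} [l.NeBot] {N : ℕ}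
    {P : α → ℂ[X]} {P₀ : ℂ[X]} (h₀ : P₀ ≠ 0) (hdeg : ∀ᶠ s in l, (P s).natDegree ≤ N)
    (hP : ∀ k, Tendsto (fun s => (P s).coeff k) l (𝓝 (P₀.coeff k))) {b : ℂ} (hb : P₀.IsRoot b) :
    ∃ f : α → ℂ, (∀ᶠ s in l, f s ∈ (P s).roots) ∧ Tendsto f l (𝓝 b) := by
  have hdeg₀ := natDegree_le_of_tendsto_coeff hdeg hP
  have hev := tendsto_eval_of_tendsto_coeff hdeg hdeg₀ hP
  -- A comparison point: were all roots of `P s` at distance at least `ε` from `b`, the value at `y`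
  -- would be at most a constant times the value at `b`, which tends to `0`.
  obtain ⟨y, hy⟩ : ∃ y, P₀.eval y ≠ 0 := by
    by_contra! h
    exact h₀ (funext fun x => by simpa using h x)
  have hnear : ∀ ε > 0, ∀ᶠ s in l, ∃ x ∈ (P s).roots, dist x b < ε := by
    intro ε hε
    have h1 : Tendsto (fun s => (1 + ‖y - b‖ / ε) ^ N * ‖(P s).eval b‖) l (𝓝 0) := by
      have := ((hev b).norm).const_mul ((1 + ‖y - b‖ / ε) ^ N)
      rw [hb.eq_zero] at this
      simpa using this
    filter_upwards [hdeg, h1.eventually_lt (hev y).norm (norm_pos_iff.2 hy)] with s hs hlt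
    by_contra! hcon
    have h2 := (P s).norm_eval_le_of_forall_roots_le_dist hε hcon y
    have h3 : (1 + ‖y - b‖ / ε) ^ (P s).natDegree ≤ (1 + ‖y - b‖ / ε) ^ N :=
      pow_le_pow_right₀ (by have : 0 ≤ ‖y - b‖ / ε := by positivity
                            linarith) hs
    have := mul_le_mul_of_nonneg_right h3 (norm_nonneg ((P s).eval b))
    linarith
  -- Taking a root nearest to `b` gives a single selection that works for every `ε`.
  have hex : ∀ s, ∃ x, (P s).roots ≠ 0 →
      x ∈ (P s).roots ∧ ∀ z ∈ (P s).roots, dist x b ≤ dist z b := by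
    intro s
    by_cases h : (P s).roots = 0
    · exact ⟨0, fun h' => (h' h).elim⟩
    obtain ⟨x₀, hx₀⟩ := Multiset.exists_mem_of_ne_zero h
    obtain ⟨x, hx, hmin⟩ := Finset.exists_min_image (P s).roots.toFinset (fun x => dist x b)
      ⟨x₀, by simpa using hx₀⟩
    exact ⟨x, fun _ => ⟨Multiset.mem_toFinset.1 hx,
      fun z hz => hmin z (Multiset.mem_toFinset.2 hz)⟩⟩
  choose f hf using hex
  have hne : ∀ {s}, (∃ x ∈ (P s).roots, True) → (P s).roots ≠ 0 := by
    rintro s ⟨x, hx, -⟩ h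
    simp [h] at hx
  refine ⟨f, ?_, ?_⟩
  · filter_upwards [hnear 1 one_pos] with s ⟨x, hx, _⟩
    exact (hf s (hne ⟨x, hx, trivial⟩)).1
  · refine Metric.tendsto_nhds.2 fun ε hε => ?_
    filter_upwards [hnear ε hε] with s ⟨x, hx, hd⟩
    exact ((hf s (hne ⟨x, hx, trivial⟩)).2 x hx).trans_lt hd

-- A summation range independent of the degree of `p` lets coefficients of quotients pass to the
-- limit even when the degree drops.
open Polynomial in
theorem Polynomial.coeff_divByMonic_X_sub_C_eq_sum_range {p : ℂ[X]} {N : ℕ}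
    (h : p.natDegree ≤ N) (a : ℂ) (n : ℕ) :
    (p /ₘ (X - C a)).coeff n = ∑ i ∈ Finset.Icc (n + 1) N, a ^ (i - (n + 1)) * p.coeff i := by
  rw [coeff_divByMonic_X_sub_C]
  refine Finset.sum_subset (Finset.Icc_subset_Icc_right h) fun i hi hi' => ?_
  rw [coeff_eq_zero_of_natDegree_lt, mul_zero]
  simp only [Finset.mem_Icc] at hi hi'
  omega

open Polynomial in
/-- Continuity of roots: the roots of a limit `P₀ ≠ 0` of polynomials of bounded degree are,
with multiplicities, limits of roots. -/
theorem Polynomial.exists_multiset_roots_tendsto {α : Type*} {l : Filter α} [l.NeBot] {N : ℕ}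
    {P : α → ℂ[X]} {P₀ : ℂ[X]} (h₀ : P₀ ≠ 0) (hdeg : ∀ᶠ s in l, (P s).natDegree ≤ N)
    (hP : ∀ k, Tendsto (fun s => (P s).coeff k) l (𝓝 (P₀.coeff k))) :
    ∃ F : Multiset ((α → ℂ) × ℂ), F.map Prod.snd = P₀.roots ∧
      (∀ᶠ s in l, F.map (fun x => x.1 s) ≤ (P s).roots) ∧
      ∀ x ∈ F, Tendsto x.1 l (𝓝 x.2) := by
  induction hd : P₀.natDegree generalizing P P₀ with
  | zero =>
    refine ⟨0, ?_, by simp, by simp⟩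
    rw [eq_C_of_natDegree_eq_zero hd]
    simp
  | succ d ih =>
    obtain ⟨b, hb⟩ := IsAlgClosed.exists_root P₀ (by
      rw [degree_eq_natDegree h₀, hd]; exact_mod_cast d.succ_ne_zero)
    obtain ⟨f, hf, hfb⟩ := exists_root_tendsto h₀ hdeg hP hb
    have hmul₀ : (X - C b) * (P₀ /ₘ (X - C b)) = P₀ := mul_divByMonic_eq_iff_isRoot.2 hb
    have hne : P₀ /ₘ (X - C b) ≠ 0 := fun h => h₀ (by rw [← hmul₀, h, mul_zero])
    have hdeg₀ := natDegree_le_of_tendsto_coeff hdeg hP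
    -- Deflation: splitting off the converging root `f s` leaves quotients that converge to the
    -- quotient of the limit.
    obtain ⟨F, hF₀, hFs, hFt⟩ := ih (P := fun s => P s /ₘ (X - C (f s)))
      (P₀ := P₀ /ₘ (X - C b)) hne
      (by
        filter_upwards [hdeg] with s hs
        rw [natDegree_divByMonic _ (monic_X_sub_C _)]
        omega)
      (by
        intro k
        rw [coeff_divByMonic_X_sub_C_eq_sum_range hdeg₀]
        refine (tendsto_finsetSum (Finset.Icc (k + 1) N) fun i _ =>
          (hfb.pow (i - (k + 1))).mul (hP i)).congr' ?_
        filter_upwards [hdeg] with s hs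
        rw [coeff_divByMonic_X_sub_C_eq_sum_range hs])
      (by rw [natDegree_divByMonic _ (monic_X_sub_C _), hd]; simp)
    refine ⟨(f, b) ::ₘ F, ?_, ?_, ?_⟩
    · conv_rhs => rw [← hmul₀]
      rw [roots_mul (by rwa [hmul₀]), roots_X_sub_C, ← hF₀]
      simp
    · filter_upwards [hf, hFs] with s hs hle
      have hne' : P s ≠ 0 := fun h => by simp [h] at hs
      have hr : (P s).IsRoot (f s) := (mem_roots hne').1 hs
      have hmul : (X - C (f s)) * (P s /ₘ (X - C (f s))) = P s :=
        mul_divByMonic_eq_iff_isRoot.2 hr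
      conv_rhs => rw [← hmul]
      rw [roots_mul (by rwa [hmul]), roots_X_sub_C]
      simpa using hle
    · intro x hx
      rcases Multiset.mem_cons.1 hx with rfl | hx
      · exact hfb
      · exact hFt x hx

open Polynomial Classical in
/-- Near a point, a family of monic polynomials has as many roots as its limit has at that
point. -/
theorem Polynomial.exists_card_roots_filter_ball {l : Filter ℝ} [l.NeBot]
    {P : ℝ → ℂ[X]} {P₀ : ℂ[X]} (hm₀ : P₀.Monic)
    (hdeg : ∀ s, (P s).natDegree = P₀.natDegree)
    (hP : ∀ k, Tendsto (fun s => (P s).coeff k) l (𝓝 (P₀.coeff k))) (z : ℂ) :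
    ∃ r > 0, ∀ᶠ s in l, ((P s).roots.filter fun μ => μ ∈ Metric.ball z r).card
      = P₀.rootMultiplicity z := by
  obtain ⟨F, hF₀, hFs, hFt⟩ := exists_multiset_roots_tendsto hm₀.ne_zero
    (.of_forall fun s => (hdeg s).le) hP
  have hs₀ : P₀.Splits := IsAlgClosed.splits P₀
  have hcard : F.card = P₀.natDegree := by
    rw [hs₀.natDegree_eq_card_roots, ← hF₀, Multiset.card_map]
  obtain ⟨r, hr, hsep⟩ : ∃ r > 0, ∀ x ∈ P₀.roots, x ≠ z → r < dist x z := by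
    have : ∀ M : Multiset ℂ, ∃ r > 0, ∀ x ∈ M, x ≠ z → r < dist x z := by
      intro M
      induction M using Multiset.induction_on with
      | empty => exact ⟨1, one_pos, by simp⟩
      | cons a M ih =>
        obtain ⟨r, hr, h⟩ := ih
        by_cases ha : a = z
        · refine ⟨r, hr, fun x hx hxz => ?_⟩
          rcases Multiset.mem_cons.1 hx with rfl | hx
          · exact (hxz ha).elim
          · exact h x hx hxz
        · have hd : 0 < dist a z := dist_pos.2 ha
          refine ⟨min r (dist a z / 2), by positivity, fun x hx hxz => ?_⟩
          rcases Multiset.mem_cons.1 hx with rfl | hx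
          · exact (min_le_right _ _).trans_lt (by linarith)
          · exact (min_le_left _ _).trans_lt (h x hx hxz)
    exact this _
  refine ⟨r, hr, ?_⟩
  have hiff : ∀ᶠ s in l, ∀ x ∈ F, (x.1 s ∈ Metric.ball z r ↔ x.2 = z) := by
    have : ∀ x ∈ F, ∀ᶠ s in l, (x.1 s ∈ Metric.ball z r ↔ x.2 = z) := by
      intro x hx
      by_cases hxz : x.2 = z
      · have := (hFt x hx).eventually (Metric.ball_mem_nhds x.2 hr)
        filter_upwards [this] with s hs
        rw [← hxz]
        simpa using hs
      · have hx2 := hsep x.2 (hF₀ ▸ Multiset.mem_map_of_mem _ hx) hxz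
        have := ((hFt x hx).dist (tendsto_const_nhds (x := z))).eventually_const_lt hx2
        filter_upwards [this] with s hs
        simp only [Metric.mem_ball, hxz, iff_false, not_lt]
        exact hs.le
    exact Multiset.eventually_forall_mem this
  filter_upwards [hFs, hiff] with s hs hi
  -- Since the degree does not drop in the limit, no root escapes to infinity and `F` accounts for
  -- all roots.
  have heq : F.map (fun x => x.1 s) = (P s).roots := by
    refine Multiset.eq_of_le_of_card_le hs ?_
    rw [Multiset.card_map, hcard, ← hdeg s]
    exact (P s).card_roots'
  rw [← heq, Multiset.filter_map, Multiset.card_map, ← count_roots, ← hF₀,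
    Multiset.count_map]
  congr 1
  refine Multiset.filter_congr fun x hx => ?_
  rw [eq_comm (a := z)]
  exact hi x hx

/-! ### Spectral constraints from bounded channel semigroups -/

section ChannelSemigroup

variable {H : Type*} [NormedAddCommGroup H] [InnerProductSpace ℂ H]
    [FiniteDimensional ℂ H] [CompleteSpace H]

omit [CompleteSpace H] in
/-- The norm of a positive operator is at most its trace. -/
theorem ContinuousLinearMap.norm_le_re_trace_of_nonneg {T : H →L[ℂ] H} (hT : 0 ≤ T) :
    ‖T‖ ≤ (LinearMap.trace ℂ H (T : H →ₗ[ℂ] H)).re := by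
  have hpos : (T : H →ₗ[ℂ] H).IsPositive := by
    have := (ContinuousLinearMap.nonneg_iff_isPositive T).1 hT
    exact (ContinuousLinearMap.isPositive_toLinearMap_iff T).2 this
  have hsym := hpos.isSymmetric
  have hev : ∀ i, 0 ≤ hsym.eigenvalues rfl i := fun i => hpos.nonneg_eigenvalues rfl i
  have htr : (LinearMap.trace ℂ H (T : H →ₗ[ℂ] H)).re = ∑ i, hsym.eigenvalues rfl i :=
    hsym.re_trace_eq_sum_eigenvalues rfl
  rw [htr]
  refine T.opNorm_le_bound (Finset.sum_nonneg fun i _ => hev i) fun x => ?_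
  set e := hsym.eigenvectorBasis rfl with he
  have hx : T x = ∑ i, inner ℂ (e i) x • (hsym.eigenvalues rfl i : ℂ) • e i := by
    conv_lhs => rw [← e.sum_repr' x]
    rw [map_sum]
    refine Finset.sum_congr rfl fun i _ => ?_
    rw [map_smul]
    congr 1
    exact hsym.apply_eigenvectorBasis rfl i
  rw [hx, Finset.sum_mul]
  refine (norm_sum_le _ _).trans (Finset.sum_le_sum fun i _ => ?_)
  rw [norm_smul, norm_smul, e.norm_eq_one, mul_one, mul_comm]
  refine mul_le_mul ?_ ?_ (norm_nonneg _) (hev i)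
  · simp [abs_of_nonneg (hev i)]
  · simpa [e.norm_eq_one] using norm_inner_le_norm (𝕜 := ℂ) (e i) x

theorem IsCPTP.norm_apply_le {T : SuperOp H} (hT : IsCPTP T) {X : Op H} (hX : 0 ≤ X) :
    ‖T X‖ ≤ (LinearMap.trace ℂ H (X : H →ₗ[ℂ] H)).re := by
  obtain ⟨φ, hφ⟩ := hT.completelyPositive
  have h : 0 ≤ T X := by
    rw [← hφ]
    exact map_nonneg φ hX
  rw [← hT.tracePreserving X]
  exact ContinuousLinearMap.norm_le_re_trace_of_nonneg h

/-- The channels on `H` are pointwise bounded. -/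
theorem exists_bound_of_isCPTP (X : Op H) : ∃ C : ℝ, ∀ T : SuperOp H, IsCPTP T → ‖T X‖ ≤ C := by
  have hX : X ∈ Submodule.span ℂ {a : Op H | 0 ≤ a} := by
    rw [CStarAlgebra.span_nonneg]
    trivial
  induction hX using Submodule.span_induction with
  | mem X hX => exact ⟨_, fun T hT => hT.norm_apply_le hX⟩
  | zero => exact ⟨0, fun T _ => by simp⟩
  | add X Y _ _ hX hY =>
    obtain ⟨C, hC⟩ := hX
    obtain ⟨D, hD⟩ := hY
    exact ⟨C + D, fun T hT => by
      rw [map_add]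
      exact (norm_add_le _ _).trans (add_le_add (hC T hT) (hD T hT))⟩
  | smul c X _ hX =>
    obtain ⟨C, hC⟩ := hX
    exact ⟨‖c‖ * C, fun T hT => by
      rw [map_smul, norm_smul]
      exact mul_le_mul_of_nonneg_left (hC T hT) (norm_nonneg c)⟩

/-- The exponential on a generalized eigenvector of rank at most two. -/
theorem exp_smul_apply_of_apply_eq {E : Type*} [NormedAddCommGroup E] [NormedSpace ℂ E]
    [CompleteSpace E] (L : E →L[ℂ] E) {z : ℂ} {x y : E} (hx : L x = z • x + y) (hy : L y = z • y)
    (t : ℝ) : NormedSpace.exp (t • L) x = Complex.exp (t * z) • (x + (t : ℂ) • y) := by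
  -- `exp (t L)` factors as a scalar times `exp K`, and `K` kills `x` after two applications, so its
  -- series on `x` has only two terms.
  set K : E →L[ℂ] E := (t : ℂ) • (L - z • 1) with hK
  have hKx : K x = (t : ℂ) • y := by simp [hK, hx]
  have hKy : K y = 0 := by simp [hK, hy]
  have hsplit : t • L = algebraMap ℂ (E →L[ℂ] E) (t * z) + K := by
    rw [Algebra.algebraMap_eq_smul_one, hK, smul_sub, smul_smul, add_sub_cancel]
    ext v
    simp
  have hcomm : Commute (algebraMap ℂ (E →L[ℂ] E) (t * z)) K := Algebra.commutes _ _
  let _ : NormedAlgebra ℚ (E →L[ℂ] E) := NormedAlgebra.restrictScalars ℚ ℂ _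
  rw [hsplit, NormedSpace.exp_add_of_commute hcomm, ← NormedSpace.algebraMap_exp_comm,
    ← Complex.exp_eq_exp_ℂ, mul_apply_eq_comp,
    Algebra.algebraMap_eq_smul_one, smul_apply,
    one_apply_eq_self]
  congr 1
  have h1 : HasSum (fun n : ℕ => ((n.factorial : ℂ)⁻¹ • K ^ n) x) (NormedSpace.exp K x) :=
    (NormedSpace.exp_series_hasSum_exp' (𝕂 := ℂ) K).mapL (ContinuousLinearMap.apply ℂ E x)
  have h2 : HasSum (fun n : ℕ => ((n.factorial : ℂ)⁻¹ • K ^ n) x)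
      (∑ n ∈ Finset.range 2, ((n.factorial : ℂ)⁻¹ • K ^ n) x) := by
    refine hasSum_sum_of_ne_finset_zero fun n hn => ?_
    obtain ⟨k, rfl⟩ : ∃ k, n = k + 2 := ⟨n - 2, by simp at hn; omega⟩
    simp [pow_add, pow_two, hKx, hKy]
  rw [h1.unique h2]
  simp [Finset.sum_range_succ, hKx]

/-- The eigenvalues of a generator of a channel semigroup lie in the closed left half plane. -/
theorem IsCPTPGenerator.re_eigenvalue_nonpos {L : SuperOp H} (hL : IsCPTPGenerator L) {z : ℂ}
    (hz : Module.End.HasEigenvalue (L : Op H →ₗ[ℂ] Op H) z) : z.re ≤ 0 := by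
  obtain ⟨X, hX⟩ := hz.exists_hasEigenvector
  have hX' : L X = z • X := hX.apply_eq_smul
  obtain ⟨C, hC⟩ := exists_bound_of_isCPTP X
  by_contra! hpos
  have hb : ∀ t : ℝ, 0 ≤ t → Real.exp (t * z.re) * ‖X‖ ≤ C := by
    intro t ht
    have := hC _ (hL t ht)
    rw [exp_smul_apply_of_apply_eq L (y := 0) (by simpa using hX') (by simp) t] at this
    simpa [norm_smul, Complex.norm_exp] using this
  have hlim : Tendsto (fun t : ℝ => Real.exp (t * z.re) * ‖X‖) atTop atTop :=
    (Real.tendsto_exp_atTop.comp (tendsto_id.atTop_mul_const hpos)).atTop_mul_const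
      (norm_pos_iff.2 hX.2)
  obtain ⟨t, ht, ht'⟩ := ((eventually_ge_atTop 0).and (hlim.eventually_gt_atTop C)).exists
  exact absurd (hb t ht) (not_le.2 ht')

/-- The imaginary eigenvalues of a generator of a channel semigroup are semisimple. -/
theorem IsCPTPGenerator.eq_zero_of_apply_eq_smul_add {L : SuperOp H} (hL : IsCPTPGenerator L) {ω : ℝ}
    {X Y : Op H} (hX : L X = (Complex.I * ω) • X + Y) (hY : L Y = (Complex.I * ω) • Y) :
    Y = 0 := by
  obtain ⟨C, hC⟩ := exists_bound_of_isCPTP X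
  by_contra hne
  -- A Jordan chain at an imaginary eigenvalue would make the orbit of `X` grow linearly.
  have hb : ∀ t : ℝ, 0 ≤ t → t * ‖Y‖ ≤ C + ‖X‖ := by
    intro t ht
    have h1 := hC _ (hL t ht)
    rw [exp_smul_apply_of_apply_eq L hX hY t, norm_smul] at h1
    have h2 : ‖Complex.exp (t * (Complex.I * ω))‖ = 1 := by simp [Complex.norm_exp]
    rw [h2, one_mul] at h1
    have h3 : ‖(t : ℂ) • Y‖ ≤ ‖X + (t : ℂ) • Y‖ + ‖X‖ := by
      simpa using norm_sub_le (X + (t : ℂ) • Y) X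
    rw [norm_smul, Complex.norm_real, Real.norm_of_nonneg ht] at h3
    linarith
  have hlim : Tendsto (fun t : ℝ => t * ‖Y‖) atTop atTop :=
    tendsto_id.atTop_mul_const (norm_pos_iff.2 hne)
  obtain ⟨t, ht, ht'⟩ :=
    ((eventually_ge_atTop 0).and (hlim.eventually_gt_atTop (C + ‖X‖))).exists
  exact absurd (hb t ht) (not_le.2 ht')

end ChannelSemigroup

/-! ### Polynomial families with differentiable coefficients -/

open Polynomial in
/-- The coefficients of a family of polynomials are differentiable at `0`. -/
def DifferentiableCoeffs (P : ℝ → ℂ[X]) : Prop :=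
  ∀ k, DifferentiableAt ℝ (fun s => (P s).coeff k) 0

namespace DifferentiableCoeffs
open Polynomial

theorem const (p : ℂ[X]) : DifferentiableCoeffs fun _ => p := fun _ => differentiableAt_const _

theorem scalar {f : ℝ → ℂ} (hf : DifferentiableAt ℝ f 0) :
    DifferentiableCoeffs fun s => C (f s) := by
  intro k
  simp only [coeff_C]
  split_ifs
  · exact hf
  · exact differentiableAt_const _

theorem sub {P Q : ℝ → ℂ[X]} (hP : DifferentiableCoeffs P) (hQ : DifferentiableCoeffs Q) :
    DifferentiableCoeffs fun s => P s - Q s := fun k => by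
  simpa only [coeff_sub] using (hP k).fun_sub (hQ k)

theorem mul {P Q : ℝ → ℂ[X]} (hP : DifferentiableCoeffs P) (hQ : DifferentiableCoeffs Q) :
    DifferentiableCoeffs fun s => P s * Q s := fun k => by
  simp only [coeff_mul]
  exact DifferentiableAt.fun_sum fun x _ => (hP x.1).fun_mul (hQ x.2)

theorem sum {ι : Type*} (S : Finset ι) {P : ι → ℝ → ℂ[X]}
    (h : ∀ i ∈ S, DifferentiableCoeffs (P i)) : DifferentiableCoeffs fun s => ∑ i ∈ S, P i s :=
  fun k => by
    simp only [finsetSum_coeff]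
    exact DifferentiableAt.fun_sum fun i hi => h i hi k

theorem prod {ι : Type*} (S : Finset ι) {P : ι → ℝ → ℂ[X]}
    (h : ∀ i ∈ S, DifferentiableCoeffs (P i)) :
    DifferentiableCoeffs fun s => ∏ i ∈ S, P i s := by
  classical
  induction S using Finset.induction_on with
  | empty => simpa using const 1
  | insert a S ha ih =>
    simp only [Finset.prod_insert ha]
    exact (h a (by simp)).mul (ih fun i hi => h i (by simp [hi]))

theorem det {n : Type*} [Fintype n] [DecidableEq n] {M : ℝ → Matrix n n ℂ[X]}
    (h : ∀ i j, DifferentiableCoeffs fun s => M s i j) :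
    DifferentiableCoeffs fun s => (M s).det := by
  simp only [Matrix.det_apply']
  exact sum _ fun σ _ => (const _).mul (prod _ fun i _ => h _ _)

theorem comp {P : ℝ → ℂ[X]} (hP : DifferentiableCoeffs P) {N : ℕ}
    (hN : ∀ s, (P s).natDegree ≤ N) (q : ℂ[X]) : DifferentiableCoeffs fun s => (P s).comp q := by
  have : (fun s => (P s).comp q) =
      fun s => ∑ k ∈ Finset.range (N + 1), C ((P s).coeff k) * q ^ k := by
    funext s
    rw [Polynomial.comp, eval₂_eq_sum_range' _ (Nat.lt_succ_of_le (hN s))]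
  rw [this]
  exact sum _ fun k _ => (scalar (hP k)).mul (const _)

end DifferentiableCoeffs

/-- Shifting the power series keeps differentiability at `0` after one division by `s`; the order
beyond the slope depends on it. -/
theorem AnalyticAt.differentiableAt_dslope {f : ℝ → ℂ} (hf : AnalyticAt ℝ f 0) :
    DifferentiableAt ℝ (dslope f 0) 0 := by
  obtain ⟨p, hp⟩ := hf
  exact hp.has_fpower_series_dslope_fslope.analyticAt.differentiableAt

/-! ### Removing the factor `s ^ m` from the characteristic polynomial -/

open Polynomial in
/-- If an analytic family of matrices has the value `0 ⊕ E` at `0` with `E` invertible, then the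
rescaled characteristic polynomial is a power of `s` times a polynomial of the rank of the
zero block. -/
theorem exists_reduced_charpoly {ι₁ ι₂ : Type*} [Fintype ι₁] [Fintype ι₂] [DecidableEq ι₁]
    [DecidableEq ι₂] (A : ℝ → Matrix (ι₁ ⊕ ι₂) (ι₁ ⊕ ι₂) ℂ)
    (hA : ∀ i j, AnalyticAt ℝ (fun s => A s i j) 0) {E : Matrix ι₂ ι₂ ℂ} (hE : E.det ≠ 0)
    (hA₀ : A 0 = Matrix.fromBlocks 0 0 0 E) :
    ∃ (Q : ℝ → ℂ[X]) (N : ℕ), DifferentiableCoeffs Q ∧ (∀ s, (Q s).natDegree ≤ N) ∧ Q 0 ≠ 0 ∧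
      (Q 0).natDegree = Fintype.card ι₁ ∧
      ∀ s : ℝ, (A s).charpoly.comp (C (s : ℂ) * X) = C ((s : ℂ) ^ Fintype.card ι₁) * Q s := by
  classical
  -- The rows of `s X - A s` in the zero block vanish at `s = 0`; here they are divided by `s`, the
  -- others being left alone.
  let M : ℝ → Matrix (ι₁ ⊕ ι₂) (ι₁ ⊕ ι₂) ℂ[X] := fun s i j =>
    i.elim (fun _ => (if i = j then X else 0) - C (dslope (fun s => A s i j) 0 s))
      (fun _ => (if i = j then C (s : ℂ) * X else 0) - C (A s i j))
  have hs : DifferentiableAt ℝ (fun s : ℝ => (s : ℂ)) 0 := Complex.ofRealCLM.differentiableAt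
  have hM : DifferentiableCoeffs fun s => (M s).det := by
    refine .det fun i j => ?_
    rcases i with i | i
    · exact (DifferentiableCoeffs.const _).sub (.scalar (hA _ _).differentiableAt_dslope)
    · refine DifferentiableCoeffs.sub ?_ (.scalar (hA _ _).differentiableAt)
      split_ifs
      · exact (DifferentiableCoeffs.scalar hs).mul (.const _)
      · exact .const _
  have hdeg : ∀ s, (M s).det.natDegree ≤ Fintype.card (ι₁ ⊕ ι₂) := by
    intro s
    rw [Matrix.det_apply]
    refine natDegree_sum_le_of_forall_le _ _ fun σ _ => ?_
    refine (natDegree_smul_le _ _).trans ((natDegree_prod_le _ _).trans ?_)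
    refine (Finset.sum_le_card_nsmul _ _ 1 fun i _ => ?_).trans (by simp)
    change (M s (σ i) i).natDegree ≤ 1
    rcases h : σ i with k | k <;> simp only [M, Sum.elim_inl, Sum.elim_inr] <;> split_ifs <;>
      compute_degree <;> simp
  -- At `s = 0` the lower left block vanishes and the lower right one is the constant `-E`, so only
  -- the compressed first derivative contributes to the degree.
  have hdet₀ : (M 0).det =
      (Matrix.of fun i j => dslope (fun s => A s (.inl i) (.inl j)) 0 0 :
        Matrix ι₁ ι₁ ℂ).charpoly * C (-E).det := by
    have : M 0 = Matrix.fromBlocks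
        (Matrix.of fun i j => dslope (fun s => A s (.inl i) (.inl j)) 0 0).charmatrix
        (Matrix.of fun i j => -C (dslope (fun s => A s (.inl i) (.inr j)) 0 0)) 0
        (C.mapMatrix (-E)) := by
      ext i j : 2
      rcases i with i | i <;> rcases j with j | j <;>
        simp [M, hA₀, Matrix.charmatrix_apply, Matrix.diagonal_apply]
    rw [this, Matrix.det_fromBlocks_zero₂₁, Matrix.charpoly, RingHom.map_det]
  have hE' : (-E).det ≠ 0 := by
    rw [Matrix.det_neg]
    exact mul_ne_zero (pow_ne_zero _ (by simp)) hE
  refine ⟨fun s => (M s).det, _, hM, hdeg, ?_, ?_, fun s => ?_⟩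
  · simp only [hdet₀]
    exact mul_ne_zero (Matrix.charpoly_monic _).ne_zero (C_ne_zero.2 hE')
  · simp only [hdet₀]
    rw [natDegree_mul_C hE', Matrix.charpoly_natDegree_eq_dim]
  · let v : ι₁ ⊕ ι₂ → ℂ[X] := Sum.elim (fun _ => C (s : ℂ)) fun _ => 1
    have hrow : (compRingHom (C (s : ℂ) * X)).mapMatrix (A s).charmatrix
        = Matrix.diagonal v * M s := by
      ext i j : 2
      rw [Matrix.diagonal_mul]
      rcases i with i | i
      · have h := sub_smul_dslope (fun s => A s (.inl i) j) 0 s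
        have h0 : A 0 (.inl i) j = 0 := by rw [hA₀]; rcases j with j | j <;> rfl
        simp only [sub_zero, h0, Complex.real_smul] at h
        simp only [RingHom.mapMatrix_apply, Matrix.map_apply, Matrix.charmatrix_apply, v, M,
          Sum.elim_inl, map_sub, coe_compRingHom_apply, C_comp, Matrix.diagonal_apply, mul_sub]
        rw [← C_mul, h]
        split_ifs <;> simp
      · simp only [RingHom.mapMatrix_apply, Matrix.map_apply, Matrix.charmatrix_apply, v, M,
          Sum.elim_inr, map_sub, coe_compRingHom_apply, C_comp, Matrix.diagonal_apply, one_mul]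
        split_ifs <;> simp
    rw [Matrix.charpoly, ← coe_compRingHom_apply, RingHom.map_det, hrow, Matrix.det_mul,
      Matrix.det_diagonal, Fintype.prod_sum_type]
    simp [v]

/-! ### Splitting of a multiple root into fractional-power branches -/

-- An invertible affine substitution preserves multiplicities, so rescaled roots can be carried back
-- as multisets.
open Polynomial in
theorem Polynomial.roots_eq_map_roots_comp (q : ℂ[X]) {c : ℂ} (hc : c ≠ 0) (y : ℂ) :
    q.roots = (q.comp (C c * X + C y)).roots.map fun w => c * w + y := by
  classical
  ext z
  have hinj : Function.Injective fun w : ℂ => c * w + y := fun w w' h => by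
    simpa [hc] using h
  obtain ⟨w, rfl⟩ : ∃ w, c * w + y = z := ⟨(z - y) / c, by field_simp; ring⟩
  rw [Multiset.count_map_eq_count' _ _ hinj, count_roots, count_roots,
    rootMultiplicity_comp_C_mul_X_add_C _ _ _ _ hc.isUnit]

theorem tendsto_ofReal_cpow_inv {p : ℕ} (hp : 1 ≤ p) :
    Tendsto (fun s : ℝ => (s : ℂ) ^ (1 / (p : ℂ))) (𝓝[≠] 0) (𝓝 0) := by
  have hp0 : (p : ℂ) ≠ 0 := by exact_mod_cast (by omega : p ≠ 0)
  have hre : 0 < (1 / (p : ℂ)).re := by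
    rw [← Complex.ofReal_natCast, ← Complex.ofReal_one, ← Complex.ofReal_div, Complex.ofReal_re]
    positivity
  have h := (Complex.continuousAt_cpow_zero_of_re_pos hre).tendsto
  have h2 : Tendsto (fun s : ℝ => ((s : ℂ), 1 / (p : ℂ))) (𝓝[≠] 0) (𝓝 ((0 : ℂ), 1 / (p : ℂ))) := by
    refine Tendsto.mono_left ?_ nhdsWithin_le_nhds
    have : Continuous fun s : ℝ => ((s : ℂ), 1 / (p : ℂ)) := by fun_prop
    simpa using this.tendsto 0
  have h3 := h.comp h2
  have hne : 1 / (p : ℂ) ≠ 0 := by simp; omega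
  simpa [Function.comp_def, Complex.zero_cpow, hne, hp0] using h3

theorem ofReal_cpow_inv_pow {p : ℕ} (hp : 1 ≤ p) (s : ℝ) :
    ((s : ℂ) ^ (1 / (p : ℂ))) ^ p = s := by
  rw [one_div, Complex.cpow_nat_inv_pow _ (by omega)]

theorem ofReal_cpow_inv_ne_zero (p : ℕ) {s : ℝ} (hs : s ≠ 0) :
    (s : ℂ) ^ (1 / (p : ℂ)) ≠ 0 := by
  rw [Complex.cpow_ne_zero_iff]
  exact .inl (by exact_mod_cast hs)

open Polynomial in
/-- A root of multiplicity `p` of a family of polynomials with differentiable coefficients splits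
into `p` roots with an expansion in `s ^ (1 / p)` to first order, whose leading coefficients are
the roots of a binomial `c X ^ p + d` with `c ≠ 0`. -/
theorem DifferentiableCoeffs.exists_branches {Q : ℝ → ℂ[X]} (hQ : DifferentiableCoeffs Q) {N : ℕ}
    (hN : ∀ s, (Q s).natDegree ≤ N) (h₀ : Q 0 ≠ 0) {y : ℂ} (hy : (Q 0).IsRoot y) {p : ℕ}
    (hp : (Q 0).rootMultiplicity y = p) :
    ∃ F : Multiset ((ℝ → ℂ) × ℂ), F.card = p ∧
      (∀ᶠ s : ℝ in 𝓝[≠] 0,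
        F.map (fun x => (s : ℂ) ^ (1 / (p : ℂ)) * x.1 s + y) ≤ (Q s).roots) ∧
      ∀ x ∈ F, Tendsto x.1 (𝓝[≠] 0) (𝓝 x.2) := by
  have hp1 : 1 ≤ p := hp ▸ (rootMultiplicity_pos h₀).2 hy
  set t : ℝ → ℂ := fun s => (s : ℂ) ^ (1 / (p : ℂ)) with ht
  have ht0 : Tendsto t (𝓝[≠] 0) (𝓝 0) := tendsto_ofReal_cpow_inv hp1
  have htp : ∀ s : ℝ, t s ^ p = s := ofReal_cpow_inv_pow hp1
  set R : ℝ → ℂ[X] := fun s => (Q s).comp (X + C y) with hR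
  have hRd : DifferentiableCoeffs R := hQ.comp hN _
  have hR₀ : ∀ k < p, (R 0).coeff k = 0 := by
    intro k hk
    have hdvd : (X - C y) ^ p ∣ Q 0 := hp ▸ pow_rootMultiplicity_dvd _ _
    obtain ⟨q, hq⟩ := hdvd
    have : R 0 = X ^ p * q.comp (X + C y) := by simp [hR, hq]
    rw [this, coeff_X_pow_mul', if_neg (by omega)]
  have hRp : (R 0).coeff p ≠ 0 := by
    obtain ⟨q, hq, hq'⟩ := exists_eq_pow_rootMultiplicity_mul_and_not_dvd (Q 0) h₀ y
    rw [hp] at hq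
    have : R 0 = X ^ p * q.comp (X + C y) := by simp only [hR]; rw [hq]; simp
    rw [this, coeff_X_pow_mul', if_pos le_rfl, Nat.sub_self, coeff_zero_eq_eval_zero, eval_comp]
    simpa [dvd_iff_isRoot] using hq'
  set d : ℕ → ℂ := fun k => deriv (fun s => (R s).coeff k) 0 with hd
  have hder : ∀ k < p, Tendsto (fun s : ℝ => (s : ℂ)⁻¹ * (R s).coeff k) (𝓝[≠] 0) (𝓝 (d k)) := by
    intro k hk
    have := hasDerivAt_iff_tendsto_slope.1 (hRd k).hasDerivAt
    refine this.congr fun s => ?_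
    simp [slope_def_module, hR₀ k hk]
  have hcont : ∀ k, Tendsto (fun s : ℝ => (R s).coeff k) (𝓝[≠] 0) (𝓝 ((R 0).coeff k)) :=
    fun k => (hRd k).continuousAt.tendsto.mono_left nhdsWithin_le_nhds
  -- For `k < p` the coefficient of `R s` is `O(s)`, so after division by `s` the power `t s ^ k`
  -- kills all but `k = 0`. At `k = p` the power cancels `s`, and higher terms vanish. If `d 0 = 0`
  -- the limit still has degree `p`, with all its roots at `0`.
  set T : ℝ → ℂ[X] := fun s => C ((s : ℂ)⁻¹) * (Q s).comp (C (t s) * X + C y) with hT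
  have hTc : ∀ s k, (T s).coeff k = (s : ℂ)⁻¹ * (R s).coeff k * t s ^ k := by
    intro s k
    have : (Q s).comp (C (t s) * X + C y) = (R s).comp (C (t s) * X) := by
      simp [hR, comp_assoc]
    rw [hT, coeff_C_mul, this, comp_C_mul_X_coeff, mul_assoc]
  set T₀ : ℂ[X] := C ((R 0).coeff p) * X ^ p + C (d 0) with hT₀
  have hT₀d : T₀.natDegree = p := by
    rw [hT₀, natDegree_add_C, natDegree_C_mul_X_pow _ _ hRp]
  have hT₀0 : T₀ ≠ 0 := fun h => by
    rw [h, natDegree_zero] at hT₀d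
    omega
  have hlim : ∀ k, Tendsto (fun s => (T s).coeff k) (𝓝[≠] 0) (𝓝 (T₀.coeff k)) := by
    intro k
    simp only [hTc]
    have hT₀c : T₀.coeff k = (if k = p then (R 0).coeff p else 0) + if k = 0 then d 0 else 0 := by
      simp [hT₀, coeff_C, coeff_X_pow]
    rw [hT₀c]
    rcases lt_trichotomy k p with hk | rfl | hk
    · rw [if_neg hk.ne, zero_add]
      split_ifs with hk0
      · subst hk0
        simpa using hder 0 hk
      · simpa [hk0] using (hder k hk).mul (ht0.pow k)
    · rw [if_pos rfl, if_neg (by omega), add_zero]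
      refine (hcont k).congr' ?_
      filter_upwards [self_mem_nhdsWithin] with s hs
      have hs' : (s : ℂ) ≠ 0 := by exact_mod_cast hs
      rw [htp]
      field_simp
    · rw [if_neg hk.ne', if_neg (by omega), add_zero]
      have : Tendsto (fun s => (R s).coeff k * t s ^ (k - p)) (𝓝[≠] 0) (𝓝 0) := by
        simpa [Nat.sub_ne_zero_of_lt hk] using (hcont k).mul (ht0.pow (k - p))
      refine this.congr' ?_
      filter_upwards [self_mem_nhdsWithin] with s hs
      have hs' : (s : ℂ) ≠ 0 := by exact_mod_cast hs
      obtain ⟨j, rfl⟩ : ∃ j, k = p + j := ⟨k - p, by omega⟩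
      rw [pow_add, htp, Nat.add_sub_cancel_left]
      field_simp
  have hTdeg : ∀ s, (T s).natDegree ≤ N := by
    intro s
    refine (natDegree_C_mul_le _ _).trans (natDegree_comp_le.trans ?_)
    calc _ ≤ N * 1 := Nat.mul_le_mul (hN s) (natDegree_linear_le)
      _ = N := mul_one N
  obtain ⟨F, hF₀, hFs, hFt⟩ := exists_multiset_roots_tendsto hT₀0 (.of_forall hTdeg) hlim
  refine ⟨F, ?_, ?_, hFt⟩
  · rw [← Multiset.card_map Prod.snd F, hF₀, ← (IsAlgClosed.splits T₀).natDegree_eq_card_roots,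
      hT₀d]
  · filter_upwards [hFs, self_mem_nhdsWithin] with s hs hs0
    have hs' : (s : ℂ)⁻¹ ≠ 0 := inv_ne_zero (by exact_mod_cast hs0)
    rw [roots_eq_map_roots_comp (Q s) (ofReal_cpow_inv_ne_zero p hs0) y]
    rw [hT, roots_C_mul _ hs'] at hs
    have := Multiset.map_le_map (f := fun w => t s * w + y) hs
    rw [Multiset.map_map] at this
    exact this

/-! ### Reduction at a semisimple eigenvalue -/

/-- If `ker A² = ker A`, then in a suitable basis `A` is the direct sum of zero and an invertible
matrix. -/
theorem LinearMap.exists_basis_toMatrix_eq_fromBlocks {V : Type*} [AddCommGroup V] [Module ℂ V]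
    [FiniteDimensional ℂ V] (A : V →ₗ[ℂ] V) (h : ∀ x, A (A x) = 0 → A x = 0) :
    ∃ (m n : ℕ) (b : Module.Basis (Fin m ⊕ Fin n) ℂ V) (E : Matrix (Fin n) (Fin n) ℂ),
      E.det ≠ 0 ∧ LinearMap.toMatrix b b A = Matrix.fromBlocks 0 0 0 E := by
  have hdisj : Disjoint (LinearMap.ker A) (LinearMap.range A) := by
    rw [Submodule.disjoint_def]
    rintro _ hx ⟨x, rfl⟩
    exact h x hx
  have hcompl : IsCompl (LinearMap.ker A) (LinearMap.range A) := by
    refine ⟨hdisj, codisjoint_iff.2 (Submodule.eq_top_of_disjoint _ _ ?_ hdisj)⟩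
    rw [← A.finrank_range_add_finrank_ker, add_comm]
  set e := Submodule.prodEquivOfIsCompl _ _ hcompl with he
  set b₁ := Module.finBasis ℂ (LinearMap.ker A)
  set b₂ := Module.finBasis ℂ (LinearMap.range A)
  set B : LinearMap.range A →ₗ[ℂ] LinearMap.range A :=
    A.restrict fun x _ => LinearMap.mem_range_self A x with hB
  have hBdet : LinearMap.det B ≠ 0 := by
    intro h0
    have := LinearMap.bot_lt_ker_of_det_eq_zero h0
    refine this.ne' (LinearMap.ker_eq_bot'.2 ?_)
    rintro ⟨_, x, rfl⟩ hx
    exact Subtype.ext (h x (congrArg Subtype.val hx))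
  have hA : ∀ v, A (e v) = e ((0 : _ →ₗ[ℂ] _).prodMap B v) := by
    rintro ⟨x, y⟩
    have hx : A (x : V) = 0 := x.2
    simp [he, hx, hB]
  refine ⟨_, _, (b₁.prod b₂).map e, LinearMap.toMatrix b₂ b₂ B, ?_, ?_⟩
  · rwa [LinearMap.det_toMatrix]
  · rw [← map_zero (LinearMap.toMatrix b₁ b₁), ← LinearMap.toMatrix_prodMap]
    ext i j
    simp only [LinearMap.toMatrix_apply, Module.Basis.map_apply, Module.Basis.map_repr,
      LinearEquiv.trans_apply, hA, LinearEquiv.symm_apply_apply]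

open Polynomial in
theorem Polynomial.rootMultiplicity_zero_X_pow_mul {n : ℕ} {q : ℂ[X]} (hq : q.eval 0 ≠ 0) :
    (X ^ n * q).rootMultiplicity 0 = n := by
  have hq0 : q ≠ 0 := by
    rintro rfl
    simp at hq
  rw [rootMultiplicity_mul (mul_ne_zero (pow_ne_zero _ X_ne_zero) hq0),
    rootMultiplicity_eq_zero hq]
  have := rootMultiplicity_X_sub_C_pow (R := ℂ) 0 n
  simpa using this

section Reduction

variable {H : Type*} [NormedAddCommGroup H] [InnerProductSpace ℂ H]
    [FiniteDimensional ℂ H] [CompleteSpace H]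

theorem SuperOp.analyticAt_toMatrix {L : ℝ → SuperOp H} (hL : AnalyticAt ℝ L 0) {ι : Type*}
    [Fintype ι] [DecidableEq ι] (b : Module.Basis ι ℂ (Op H)) (i j : ι) :
    AnalyticAt ℝ (fun s => LinearMap.toMatrix b b (L s : Op H →ₗ[ℂ] Op H) i j) 0 := by
  let c : SuperOp H →L[ℂ] ℂ := (b.coord i).toContinuousLinearMap ∘L
    ContinuousLinearMap.apply ℂ (Op H) (b j)
  have := ((c.restrictScalars ℝ).analyticAt (L 0)).comp hL
  refine this.congr (.of_forall fun s => ?_)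
  simp [c, LinearMap.toMatrix_apply]

theorem SuperOp.differentiableCoeffs_charpoly {L : ℝ → SuperOp H} (hL : AnalyticAt ℝ L 0) :
    DifferentiableCoeffs fun s => SuperOp.charpoly (L s) := by
  set b := Module.finBasis ℂ (Op H)
  have : ∀ s, SuperOp.charpoly (L s) =
      (LinearMap.toMatrix b b (L s : Op H →ₗ[ℂ] Op H)).charmatrix.det := fun s =>
    (LinearMap.charpoly_toMatrix _ b).symm
  simp only [this]
  refine .det fun i j => ?_
  simp only [Matrix.charmatrix_apply]
  exact (DifferentiableCoeffs.const _).sub (.scalar (analyticAt_toMatrix hL b i j).differentiableAt)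

open Polynomial in
/-- The reduction process at a semisimple imaginary eigenvalue. -/
theorem SuperOp.exists_reduced_charpoly {L : ℝ → SuperOp H} (hL : AnalyticAt ℝ L 0)
    (hgen : IsCPTPGenerator (L 0)) (ω : ℝ) {m : ℕ}
    (hm : (SuperOp.charpoly (L 0)).rootMultiplicity (Complex.I * ω) = m) :
    ∃ (Q : ℝ → ℂ[X]) (N : ℕ), DifferentiableCoeffs Q ∧ (∀ s, (Q s).natDegree ≤ N) ∧ Q 0 ≠ 0 ∧
      (Q 0).natDegree = m ∧
      ∀ s : ℝ, (SuperOp.charpoly (L s)).comp (C (s : ℂ) * X + C (Complex.I * ω))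
        = C ((s : ℂ) ^ m) * Q s := by
  set z : ℂ := Complex.I * ω with hz
  set A : ℝ → SuperOp H := fun s => L s - z • 1 with hA
  have hAan : AnalyticAt ℝ A 0 := hL.sub analyticAt_const
  have hAchar : ∀ s, SuperOp.charpoly (A s) = (SuperOp.charpoly (L s)).comp (X + C z) :=
    fun s => LinearMap.charpoly_sub_smul _ _
  obtain ⟨k, n, b, E, hE, hb⟩ := LinearMap.exists_basis_toMatrix_eq_fromBlocks
    (A 0 : Op H →ₗ[ℂ] Op H) (by
      intro x hx
      refine hgen.eq_zero_of_apply_eq_smul_add (X := x) (ω := ω) ?_ ?_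
      · simp [hA, hz]
      · have : L 0 (A 0 x) - z • A 0 x = 0 := hx
        exact sub_eq_zero.1 this)
  -- As `E` is invertible, the algebraic multiplicity of `0` is the size of the zero block.
  have hk : k = m := by
    have h1 : SuperOp.charpoly (A 0) = X ^ k * E.charpoly := by
      rw [SuperOp.charpoly, ← LinearMap.charpoly_toMatrix _ b, hb,
        Matrix.charpoly_fromBlocks_zero₁₂, Matrix.charpoly_zero, Fintype.card_fin]
    have h2 := rootMultiplicity_comp_C_mul_X_add_C (SuperOp.charpoly (L 0)) 1 z 0 isUnit_one
    rw [C_1, one_mul, ← hAchar, h1, mul_zero, zero_add, hm,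
      rootMultiplicity_zero_X_pow_mul] at h2
    · exact h2
    · rw [← coeff_zero_eq_eval_zero]
      intro h0
      apply hE
      rw [Matrix.det_eq_sign_charpoly_coeff, h0, mul_zero]
  obtain ⟨Q, N, hQ, hN, hQ0, hQd, hQs⟩ := _root_.exists_reduced_charpoly
    (fun s => LinearMap.toMatrix b b (A s : Op H →ₗ[ℂ] Op H))
    (fun i j => analyticAt_toMatrix hAan b i j) hE hb
  rw [Fintype.card_fin, hk] at hQd
  refine ⟨Q, N, hQ, hN, hQ0, hQd, fun s => ?_⟩
  have := hQs s
  rw [LinearMap.charpoly_toMatrix, Fintype.card_fin, hk] at this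
  rw [← this]
  change _ = (SuperOp.charpoly (A s)).comp _
  rw [hAchar]
  simp [comp_assoc]

end Reduction

/-! ### Branch expansions -/

/-- Each point is counted by at most one summand. The summands will be the groups of branches with a
common slope. -/
theorem Multiset.finset_sum_le_of_pairwise_disjoint {ι α : Type*} [DecidableEq α] {S : Finset ι}
    {G : ι → Multiset α} {R : Multiset α} (hle : ∀ i ∈ S, G i ≤ R)
    (hd : ∀ i ∈ S, ∀ j ∈ S, i ≠ j → ∀ x ∈ G i, x ∉ G j) : ∑ i ∈ S, G i ≤ R := by
  classical
  refine Multiset.le_iff_count.2 fun x => ?_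
  rw [Multiset.count_sum']
  by_cases h : ∃ i ∈ S, x ∈ G i
  · obtain ⟨i, hi, hx⟩ := h
    rw [Finset.sum_eq_single_of_mem i hi fun j hj hji =>
      Multiset.count_eq_zero.2 (hd i hi j hj hji.symm x hx)]
    exact Multiset.le_iff_count.1 (hle i hi) x
  · push Not at h
    rw [Finset.sum_eq_zero fun i hi => Multiset.count_eq_zero.2 (h i hi)]
    exact Nat.zero_le _

theorem Multiset.exists_eq_map_univ {α : Type*} {F : Multiset α} {m : ℕ} (h : F.card = m) :
    ∃ g : Fin m → α, F = Finset.univ.val.map g := by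
  obtain ⟨l, rfl⟩ := Quotient.exists_rep F
  have hl : l.length = m := h
  subst hl
  exact ⟨l.get, by rw [Fin.univ_val_map, List.ofFn_get]; rfl⟩

/-- `f` has the expansion `i ω + i a s + b s ^ (1 + 1 / p) + o(s ^ (1 + 1 / p))` along
`l`. -/
def HasBranchExpansion (l : Filter ℝ) (ω : ℝ) (f : ℝ → ℂ) (a : ℝ) (b : ℂ) (p : ℕ) : Prop :=
  Tendsto (fun s : ℝ => (f s - (Complex.I * ω + Complex.I * a * s)) /
    (s * (s : ℂ) ^ (1 / (p : ℂ)))) l (𝓝 b)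

theorem ofReal_mul_cpow_ne_zero (p : ℕ) {s : ℝ} (hs : s ≠ 0) :
    (s : ℂ) * (s : ℂ) ^ (1 / (p : ℂ)) ≠ 0 :=
  mul_ne_zero (by exact_mod_cast hs) (ofReal_cpow_inv_ne_zero p hs)

/-- The remainder is smaller than `s` by the factor `s ^ (1 / p)`. Recovering the slope is what
tells branches from different roots of `Q 0` apart. -/
theorem HasBranchExpansion.tendsto_div {l : Filter ℝ} (hl : l ≤ 𝓝[≠] 0) {ω : ℝ} {f : ℝ → ℂ}
    {a : ℝ} {b : ℂ} {p : ℕ} (hp : 1 ≤ p) (h : HasBranchExpansion l ω f a b p) :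
    Tendsto (fun s : ℝ => (f s - Complex.I * ω) / s) l (𝓝 (Complex.I * a)) := by
  have h1 : Tendsto (fun s : ℝ => Complex.I * a + (s : ℂ) ^ (1 / (p : ℂ)) *
      ((f s - (Complex.I * ω + Complex.I * a * s)) / (s * (s : ℂ) ^ (1 / (p : ℂ))))) l
      (𝓝 (Complex.I * a + 0 * b)) :=
    (((tendsto_ofReal_cpow_inv hp).mono_left hl).mul h).const_add _
  rw [zero_mul, add_zero] at h1
  refine h1.congr' ?_
  filter_upwards [hl self_mem_nhdsWithin] with s hs
  have hs' : (s : ℂ) ≠ 0 := by exact_mod_cast hs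
  have ht := ofReal_cpow_inv_ne_zero p hs
  field_simp
  ring

theorem HasBranchExpansion.tendsto {l : Filter ℝ} (hl : l ≤ 𝓝[≠] 0) {ω : ℝ} {f : ℝ → ℂ}
    {a : ℝ} {b : ℂ} {p : ℕ} (hp : 1 ≤ p) (h : HasBranchExpansion l ω f a b p) :
    Tendsto f l (𝓝 (Complex.I * ω)) := by
  have hs : Tendsto (fun s : ℝ => (s : ℂ)) l (𝓝 0) := by
    have := Complex.continuous_ofReal.tendsto 0
    rw [Complex.ofReal_zero] at this
    exact this.mono_left (hl.trans nhdsWithin_le_nhds)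
  have h1 := (hs.mul (h.tendsto_div hl hp)).const_add (Complex.I * ω)
  rw [zero_mul, add_zero] at h1
  refine h1.congr' ?_
  filter_upwards [hl self_mem_nhdsWithin] with s hs
  have hs' : (s : ℂ) ≠ 0 := by exact_mod_cast hs
  field_simp
  ring

theorem HasBranchExpansion.hasStableExpansion {l : Filter ℝ} {ω : ℝ} {f : ℝ → ℂ}
    {a : ℝ} {b : ℂ} {p : ℕ} (h : HasBranchExpansion (l ⊓ 𝓟 {0}ᶜ) ω f a b p) (hp : 1 ≤ p)
    (hb : b.re ≤ 0) (h0 : f 0 = Complex.I * ω) : HasStableExpansion l ω f := by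
  refine ⟨a, b, p, hp, hb, isLittleO_iff.2 fun c hc => ?_⟩
  have hp0 : (p : ℂ) ≠ 0 := by exact_mod_cast (by omega : p ≠ 0)
  have h1 := (Metric.tendsto_nhds.1 h) c hc
  rw [eventually_inf_principal] at h1
  filter_upwards [h1] with s hs
  have hexp : (1 : ℂ) + 1 / (p : ℂ) = ((1 + 1 / (p : ℝ) : ℝ) : ℂ) := by push_cast; rfl
  by_cases hs0 : s = 0
  · subst hs0
    have hne : (1 : ℂ) + 1 / (p : ℂ) ≠ 0 := by
      rw [hexp]
      have : (0 : ℝ) < 1 + 1 / (p : ℝ) := by positivity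
      exact_mod_cast this.ne'
    rw [Complex.ofReal_zero, Complex.zero_cpow hne, h0]
    simp only [mul_zero, add_zero, sub_self, norm_zero]
    positivity
  · have hs' : (s : ℂ) ≠ 0 := by exact_mod_cast hs0
    have hu := ofReal_mul_cpow_ne_zero p hs0
    have hpow : (s : ℂ) ^ ((1 : ℂ) + 1 / (p : ℂ)) = s * (s : ℂ) ^ (1 / (p : ℂ)) := by
      rw [Complex.cpow_add _ _ hs', Complex.cpow_one]
    have hnorm : ‖|s| ^ ((1 : ℝ) + 1 / (p : ℝ))‖ = ‖(s : ℂ) * (s : ℂ) ^ (1 / (p : ℂ))‖ := by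
      rw [← hpow, hexp, Complex.norm_cpow_real, Complex.norm_real, Real.norm_of_nonneg
        (by positivity), Real.norm_eq_abs]
    have hd := (hs hs0).le
    rw [dist_eq_norm] at hd
    rw [hnorm, hpow]
    calc _ = ‖((f s - (Complex.I * ω + Complex.I * a * s)) / (s * (s : ℂ) ^ (1 / (p : ℂ))) - b)
          * (s * (s : ℂ) ^ (1 / (p : ℂ)))‖ := by
          congr 1
          rw [sub_mul, div_mul_cancel₀ _ hu]
          ring
      _ ≤ _ := by
          rw [norm_mul]
          gcongr

/-! ### Continuous selections and the sign of the next coefficient -/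

/-- A continuous function whose values are among finitely many convergent functions follows those
with one fixed limit. -/
theorem exists_tendsto_of_continuousOn_of_forall_exists_eq {β : Type*} (F : Finset β)
    {f : β → ℝ → ℂ} {c : β → ℂ} (hf : ∀ x ∈ F, Tendsto (f x) (𝓝[>] 0) (𝓝 (c x)))
    {g : ℝ → ℂ} {δ : ℝ} (hδ : 0 < δ) (hg : ContinuousOn g (Set.Ioo 0 δ))
    (hgF : ∀ᶠ s in 𝓝[>] 0, ∃ x ∈ F, g s = f x s) :
    ∃ x₀ ∈ F, Tendsto g (𝓝[>] 0) (𝓝 (c x₀)) ∧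
      ∀ᶠ s in 𝓝[>] 0, ∃ x ∈ F, c x = c x₀ ∧ g s = f x s := by
  have hsep : ∀ᶠ ε : ℝ in 𝓝[>] 0, ∀ x ∈ F, ∀ y ∈ F, c x ≠ c y → ε + ε < dist (c x) (c y) := by
    refine (Finset.eventually_all F).2 fun x _ => (Finset.eventually_all F).2 fun y _ => ?_
    by_cases h : c x = c y
    · simp [h]
    · have : Tendsto (fun ε : ℝ => ε + ε) (𝓝[>] 0) (𝓝 0) := by
        have : Continuous fun ε : ℝ => ε + ε := by fun_prop
        simpa using (this.tendsto 0).mono_left nhdsWithin_le_nhds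
      filter_upwards [this.eventually_lt_const (dist_pos.2 h)] with ε hε _ using hε
  obtain ⟨ε, hε, hε0⟩ := (hsep.and self_mem_nhdsWithin).exists
  have hε0 : 0 < ε := hε0
  have hnear : ∀ η > 0, ∀ᶠ s in 𝓝[>] (0 : ℝ), ∀ x ∈ F, dist (f x s) (c x) < η := fun η hη =>
    (Finset.eventually_all F).2 fun x hx => Metric.tendsto_nhds.1 (hf x hx) η hη
  have hev := (hgF.and (hnear ε hε0)).and (Ioo_mem_nhdsGT hδ)
  obtain ⟨η, hη, hηs⟩ := mem_nhdsGT_iff_exists_Ioo_subset.1 hev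
  have hη : 0 < η := hη
  have hη2 : η / 2 ∈ Set.Ioo 0 η := ⟨by linarith, by linarith⟩
  obtain ⟨⟨⟨x₀, hx₀, hgx₀⟩, hx₀n⟩, -⟩ := hηs hη2
  have hball : ∀ s ∈ Set.Ioo 0 η, g s ∈ Metric.ball (c x₀) ε := by
    -- The balls around distinct limits are disjoint and cover the image of the interval, so the
    -- connected image stays in one of them.
    have hpre : IsPreconnected (g '' Set.Ioo 0 η) :=
      isPreconnected_Ioo.image g (hg.mono fun s hs => (hηs hs).2)
    have hsub := hpre.subset_left_of_subset_union (u := Metric.ball (c x₀) ε)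
      (v := ⋃ x ∈ {x | x ∈ F ∧ c x ≠ c x₀}, Metric.ball (c x) ε) Metric.isOpen_ball
      (isOpen_biUnion fun _ _ => Metric.isOpen_ball) ?_ ?_ ?_
    · exact fun s hs => hsub ⟨s, hs, rfl⟩
    · refine Set.disjoint_iUnion₂_right.2 fun x hx => Metric.ball_disjoint_ball ?_
      exact (hε x₀ hx₀ x hx.1 (Ne.symm hx.2)).le
    · rintro _ ⟨s, hs, rfl⟩
      obtain ⟨⟨⟨x, hx, hgx⟩, hxn⟩, -⟩ := hηs hs
      have hm : g s ∈ Metric.ball (c x) ε := by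
        rw [hgx]
        exact hxn x hx
      by_cases h : c x = c x₀
      · exact .inl (h ▸ hm)
      · exact .inr (Set.mem_iUnion₂.2 ⟨x, ⟨hx, h⟩, hm⟩)
    · refine ⟨g (η / 2), ⟨_, hη2, rfl⟩, ?_⟩
      rw [hgx₀]
      exact hx₀n x₀ hx₀
  have hsame : ∀ᶠ s in 𝓝[>] 0, ∃ x ∈ F, c x = c x₀ ∧ g s = f x s := by
    filter_upwards [Ioo_mem_nhdsGT hη] with s hs
    obtain ⟨⟨⟨x, hx, hgx⟩, hxn⟩, -⟩ := hηs hs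
    refine ⟨x, hx, ?_, hgx⟩
    by_contra h
    have h1 := hxn x hx
    have h2 := Metric.mem_ball.1 (hball s hs)
    rw [← hgx] at h1
    have h3 := hε x hx x₀ hx₀ h
    have h4 := dist_triangle_left (c x) (c x₀) (g s)
    linarith
  refine ⟨x₀, hx₀, Metric.tendsto_nhds.2 fun ρ hρ => ?_, hsame⟩
  filter_upwards [hsame, hnear ρ hρ] with s ⟨x, hx, hc, hgx⟩ hn
  rw [hgx, ← hc]
  exact hn x hx

/-- For `s > 0` the denominator is a positive real and the subtracted terms are purely imaginary, so
the quotient inherits the sign of `(f s).re`. -/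
theorem HasBranchExpansion.re_nonpos {ω : ℝ} {f : ℝ → ℂ} {a : ℝ} {b : ℂ} {p : ℕ}
    (h : HasBranchExpansion (𝓝[>] 0) ω f a b p) (hf : ∀ᶠ s in 𝓝[>] 0, (f s).re ≤ 0) :
    b.re ≤ 0 := by
  refine le_of_tendsto ((Complex.continuous_re.tendsto b).comp h) ?_
  filter_upwards [hf, self_mem_nhdsWithin] with s hs hs0
  have hs0 : 0 < s := hs0
  have hpow : (s : ℂ) * (s : ℂ) ^ (1 / (p : ℂ)) = ((s * s ^ (1 / (p : ℝ)) : ℝ) : ℂ) := by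
    rw [Complex.ofReal_mul, Complex.ofReal_cpow hs0.le]
    push_cast
    rfl
  rw [Function.comp_apply, hpow, Complex.div_ofReal_re]
  refine div_nonpos_of_nonpos_of_nonneg ?_ (by positivity)
  simpa using hs

/-! ### Assembling all branches -/

open Polynomial in
/-- The branches of the roots of `χ`, from a reduced family `Q`, when the roots of `χ` are in the
closed left half plane. -/
theorem exists_branch_multiset {χ Q : ℝ → ℂ[X]} (hQ : DifferentiableCoeffs Q) {N : ℕ}
    (hN : ∀ s, (Q s).natDegree ≤ N) (h₀ : Q 0 ≠ 0) {ω : ℝ} {m : ℕ} (hm : (Q 0).natDegree = m)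
    (hχ : ∀ s : ℝ, (χ s).comp (C (s : ℂ) * X + C (Complex.I * ω)) = C ((s : ℂ) ^ m) * Q s)
    (hre : ∀ᶠ s in 𝓝 0, ∀ z ∈ (χ s).roots, z.re ≤ 0) :
    ∃ (F : Multiset ((ℝ → ℂ) × ℝ × ℂ)) (P : ℝ → ℕ), F.card = m ∧
      (∀ᶠ s in 𝓝[≠] 0, F.map (fun x => x.1 s) ≤ (χ s).roots) ∧
      ∀ x ∈ F, 1 ≤ P x.2.1 ∧ x.2.2.re ≤ 0 ∧
        HasBranchExpansion (𝓝[≠] 0) ω x.1 x.2.1 x.2.2 (P x.2.1) := by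
  classical
  have hroots : ∀ s : ℝ, s ≠ 0 →
      (χ s).roots = (Q s).roots.map fun μ => s * μ + Complex.I * ω := by
    intro s hs
    have hs' : (s : ℂ) ≠ 0 := by exact_mod_cast hs
    rw [roots_eq_map_roots_comp (χ s) hs' (Complex.I * ω), hχ, roots_C_mul _ (pow_ne_zero _ hs')]
  have hreQ : ∀ᶠ s : ℝ in 𝓝[≠] 0, ∀ μ ∈ (Q s).roots, s * μ.re ≤ 0 := by
    filter_upwards [hre.filter_mono nhdsWithin_le_nhds, self_mem_nhdsWithin] with s hs hs0 μ hμ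
    have := hs (s * μ + Complex.I * ω) (by
      rw [hroots s hs0]
      exact Multiset.mem_map_of_mem _ hμ)
    simpa using this
  have hlim : ∀ k, Tendsto (fun s => (Q s).coeff k) (𝓝 0) (𝓝 ((Q 0).coeff k)) :=
    fun k => (hQ k).continuousAt.tendsto
  have hgt : 𝓝[>] (0 : ℝ) ≤ 𝓝[≠] 0 := nhdsWithin_mono _ fun s hs => ne_of_gt hs
  have hlt : 𝓝[<] (0 : ℝ) ≤ 𝓝[≠] 0 := nhdsWithin_mono _ fun s hs => ne_of_lt hs
  -- Approximating `y` by roots of `Q s` from `s > 0` and from `s < 0` gives opposite inequalities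
  -- for its real part.
  have him : ∀ y ∈ (Q 0).roots, y = Complex.I * y.im := by
    intro y hy
    have hy' := (mem_roots h₀).1 hy
    have h1 : y.re ≤ 0 := by
      obtain ⟨f, hf, hft⟩ := exists_root_tendsto (l := 𝓝[>] 0) h₀ (.of_forall hN)
        (fun k => (hlim k).mono_left nhdsWithin_le_nhds) hy'
      refine le_of_tendsto ((Complex.continuous_re.tendsto y).comp hft) ?_
      filter_upwards [hf, hreQ.filter_mono hgt, self_mem_nhdsWithin] with s hs hr hs0
      exact nonpos_of_mul_nonpos_right (hr _ hs) hs0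
    have h2 : 0 ≤ y.re := by
      obtain ⟨f, hf, hft⟩ := exists_root_tendsto (l := 𝓝[<] 0) h₀ (.of_forall hN)
        (fun k => (hlim k).mono_left nhdsWithin_le_nhds) hy'
      refine ge_of_tendsto ((Complex.continuous_re.tendsto y).comp hft) ?_
      filter_upwards [hf, hreQ.filter_mono hlt, self_mem_nhdsWithin] with s hs hr hs0
      have hs0 : s < 0 := hs0
      have := hr _ hs
      by_contra! hneg
      have := mul_pos_of_neg_of_neg hs0 hneg
      simp only [Function.comp_apply] at this
      linarith
    apply Complex.ext <;> simp
    linarith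
  set p : ℂ → ℕ := fun y => (Q 0).rootMultiplicity y with hp
  have hp1 : ∀ y ∈ (Q 0).roots, 1 ≤ p y := fun y hy =>
    (rootMultiplicity_pos h₀).2 ((mem_roots h₀).1 hy)
  have hex : ∀ y, ∃ G : Multiset ((ℝ → ℂ) × ℂ), y ∈ (Q 0).roots → G.card = p y ∧
      (∀ᶠ s : ℝ in 𝓝[≠] 0,
        G.map (fun x => (s : ℂ) ^ (1 / (p y : ℂ)) * x.1 s + y) ≤ (Q s).roots) ∧
      ∀ x ∈ G, Tendsto x.1 (𝓝[≠] 0) (𝓝 x.2) := by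
    intro y
    by_cases hy : y ∈ (Q 0).roots
    · obtain ⟨G, hG⟩ := hQ.exists_branches hN h₀ ((mem_roots h₀).1 hy) (p := p y) rfl
      exact ⟨G, fun _ => hG⟩
    · exact ⟨0, fun h => (hy h).elim⟩
  choose G hG using hex
  set branch : ℂ → (ℝ → ℂ) × ℂ → (ℝ → ℂ) × ℝ × ℂ := fun y x =>
    (fun s : ℝ => s * ((s : ℂ) ^ (1 / (p y : ℂ)) * x.1 s + y) + Complex.I * ω, y.im, x.2)
    with hbranch
  set F : ℂ → Multiset ((ℝ → ℂ) × ℝ × ℂ) := fun y => (G y).map (branch y) with hF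
  -- Slopes being imaginary, the exponent is a function of the real slope: branches with equal slope
  -- share it.
  set P : ℝ → ℕ := fun a => p (Complex.I * a) with hP
  have hPim : ∀ y ∈ (Q 0).roots, P y.im = p y := fun y hy => by
    simp only [hP]
    rw [← him y hy]
  have hexp : ∀ y ∈ (Q 0).roots, ∀ x ∈ F y, x.2.1 = y.im ∧
      HasBranchExpansion (𝓝[≠] 0) ω x.1 x.2.1 x.2.2 (P x.2.1) := by
    intro y hy x hx
    obtain ⟨w, hw, rfl⟩ := Multiset.mem_map.1 hx
    refine ⟨rfl, ((hG y hy).2.2 w hw).congr' ?_⟩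
    have hPy := hPim y hy
    filter_upwards [self_mem_nhdsWithin] with s hs
    have hu := ofReal_mul_cpow_ne_zero (p y) hs
    simp only [hbranch, hPy]
    rw [eq_div_iff hu, ← him y hy]
    ring
  have hleF : ∀ y ∈ (Q 0).roots, ∀ᶠ s in 𝓝[≠] 0, (F y).map (fun x => x.1 s) ≤ (χ s).roots := by
    intro y hy
    filter_upwards [(hG y hy).2.1, self_mem_nhdsWithin] with s hs hs0
    rw [hroots s hs0, hF, Multiset.map_map]
    have := Multiset.map_le_map (f := fun μ : ℂ => s * μ + Complex.I * ω) hs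
    rw [Multiset.map_map] at this
    exact this
  have hne : ∀ y ∈ (Q 0).roots, ∀ y' ∈ (Q 0).roots, y ≠ y' → ∀ x ∈ F y, ∀ x' ∈ F y',
      ∀ᶠ s in 𝓝[≠] 0, x.1 s ≠ x'.1 s := by
    intro y hy y' hy' hyy x hx x' hx'
    obtain ⟨ha, hb⟩ := hexp y hy x hx
    obtain ⟨ha', hb'⟩ := hexp y' hy' x' hx'
    have hPx : P x.2.1 = p y := by rw [ha, hPim y hy]
    have hPx' : P x'.2.1 = p y' := by rw [ha', hPim y' hy']
    have h1 := hb.tendsto_div le_rfl (hPx ▸ hp1 y hy)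
    have h2 := hb'.tendsto_div le_rfl (hPx' ▸ hp1 y' hy')
    rw [ha, ← him y hy] at h1
    rw [ha', ← him y' hy'] at h2
    filter_upwards [(h1.sub h2).eventually_ne (sub_ne_zero.2 hyy)] with s hs heq
    exact hs (by rw [heq, sub_self])
  refine ⟨∑ y ∈ (Q 0).roots.toFinset, F y, P, ?_, ?_, ?_⟩
  · rw [Multiset.card_sum, ← hm, (IsAlgClosed.splits (Q 0)).natDegree_eq_card_roots,
      ← Multiset.toFinset_sum_count_eq]
    refine Finset.sum_congr rfl fun y hy => ?_
    rw [hF, Multiset.card_map, (hG y (Multiset.mem_toFinset.1 hy)).1, count_roots]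
  · have h1 := Multiset.eventually_forall_mem hleF
    have h2 : ∀ᶠ s in 𝓝[≠] (0 : ℝ), ∀ y ∈ (Q 0).roots, ∀ y' ∈ (Q 0).roots, y ≠ y' →
        ∀ x ∈ F y, ∀ x' ∈ F y', x.1 s ≠ x'.1 s := by
      refine Multiset.eventually_forall_mem fun y hy =>
        Multiset.eventually_forall_mem fun y' hy' => ?_
      by_cases hyy : y = y'
      · simp [hyy]
      · filter_upwards [Multiset.eventually_forall_mem fun x hx =>
          Multiset.eventually_forall_mem (hne y hy y' hy' hyy x hx)] with s hs _ using hs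
    filter_upwards [h1, h2] with s hs1 hs2
    have hmap : (∑ y ∈ (Q 0).roots.toFinset, F y).map (fun x => x.1 s)
        = ∑ y ∈ (Q 0).roots.toFinset, (F y).map fun x => x.1 s :=
      map_sum (Multiset.mapAddMonoidHom fun x : (ℝ → ℂ) × ℝ × ℂ => x.1 s) _ _
    rw [hmap]
    refine Multiset.finset_sum_le_of_pairwise_disjoint
      (fun y hy => hs1 y (Multiset.mem_toFinset.1 hy)) ?_
    intro y hy y' hy' hyy z hz hz'
    obtain ⟨x, hx, rfl⟩ := Multiset.mem_map.1 hz
    obtain ⟨x', hx', heq⟩ := Multiset.mem_map.1 hz'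
    exact hs2 y (Multiset.mem_toFinset.1 hy) y' (Multiset.mem_toFinset.1 hy') hyy x hx x' hx'
      heq.symm
  · intro x hx
    obtain ⟨y, hy, hxy⟩ := Multiset.mem_sum.1 hx
    rw [Multiset.mem_toFinset] at hy
    obtain ⟨ha, hb⟩ := hexp y hy x hxy
    have hPx : P x.2.1 = p y := by rw [ha, hPim y hy]
    refine ⟨hPx ▸ hp1 y hy, HasBranchExpansion.re_nonpos (hb.mono_left hgt) ?_, hb⟩
    filter_upwards [(hleF y hy).filter_mono hgt, hre.filter_mono nhdsWithin_le_nhds] with s hs hr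
    exact hr _ (Multiset.mem_of_le hs (Multiset.mem_map_of_mem _ hxy))

section EigenvalueBranches

variable {H : Type*} [NormedAddCommGroup H] [InnerProductSpace ℂ H]
    [FiniteDimensional ℂ H] [CompleteSpace H]

omit [CompleteSpace H] in
theorem SuperOp.monic_charpoly (L : SuperOp H) : (SuperOp.charpoly L).Monic :=
  LinearMap.charpoly_monic _

omit [CompleteSpace H] in
theorem SuperOp.mem_roots_charpoly {L : SuperOp H} {z : ℂ} :
    z ∈ (SuperOp.charpoly L).roots ↔ Module.End.HasEigenvalue (L : Op H →ₗ[ℂ] Op H) z := by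
  rw [Polynomial.mem_roots (monic_charpoly L).ne_zero]
  exact (Module.End.hasEigenvalue_iff_isRoot_charpoly _ _).symm

/-- The eigenvalues near an imaginary eigenvalue of a generator, as a multiset of branches with
an expansion to first order beyond the linear term. The exponent depends only on the slope. -/
theorem exists_eigenvalue_branches {L' : ℝ → SuperOp H} (hanalytic : AnalyticAt ℝ L' 0)
    (hgen : ∀ᶠ s in 𝓝 (0 : ℝ), IsCPTPGenerator (L' s)) (ω : ℝ) :
    ∃ (F : Multiset ((ℝ → ℂ) × ℝ × ℂ)) (P : ℝ → ℕ) (r : ℝ), 0 < r ∧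
      F.card = (SuperOp.charpoly (L' 0)).rootMultiplicity (Complex.I * ω) ∧
      (∀ᶠ s in 𝓝[≠] 0,
        SuperOp.eigenvaluesNear (L' s) (Complex.I * ω) r = F.map fun x => x.1 s) ∧
      SuperOp.eigenvaluesNear (L' 0) (Complex.I * ω) r
        = Multiset.replicate F.card (Complex.I * ω) ∧
      ∀ x ∈ F, 1 ≤ P x.2.1 ∧ x.2.2.re ≤ 0 ∧
        HasBranchExpansion (𝓝[≠] 0) ω x.1 x.2.1 x.2.2 (P x.2.1) := by
  classical
  obtain ⟨Q, N, hQ, hN, hQ0, hQd, hQs⟩ :=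
    SuperOp.exists_reduced_charpoly hanalytic hgen.self_of_nhds ω rfl
  obtain ⟨F, P, hcard, hle, hF⟩ := exists_branch_multiset hQ hN hQ0 hQd hQs (by
    filter_upwards [hgen] with s hs z hz
    exact hs.re_eigenvalue_nonpos (SuperOp.mem_roots_charpoly.1 hz))
  obtain ⟨r, hr, hball⟩ := Polynomial.exists_card_roots_filter_ball (l := 𝓝 0)
    (P := fun s => SuperOp.charpoly (L' s)) (SuperOp.monic_charpoly (L' 0))
    (fun s => by simp [SuperOp.charpoly, LinearMap.charpoly_natDegree])
    (fun k => (SuperOp.differentiableCoeffs_charpoly hanalytic k).continuousAt.tendsto)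
    (Complex.I * ω)
  have hball' : ∀ᶠ s in 𝓝 0, (SuperOp.eigenvaluesNear (L' s) (Complex.I * ω) r).card
      = (SuperOp.charpoly (L' 0)).rootMultiplicity (Complex.I * ω) := by
    filter_upwards [hball] with s hs
    rw [← hs, SuperOp.eigenvaluesNear]
  refine ⟨F, P, r, hr, hcard, ?_, ?_, hF⟩
  · have hin : ∀ᶠ s in 𝓝[≠] 0, ∀ x ∈ F, x.1 s ∈ Metric.ball (Complex.I * ω) r :=
      Multiset.eventually_forall_mem fun x hx =>
        ((hF x hx).2.2.tendsto le_rfl (hF x hx).1).eventually (Metric.ball_mem_nhds _ hr)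
    -- The branches form a submultiset of the eigenvalues in the disc, and both have `m` elements.
    filter_upwards [hle, hin, hball'.filter_mono nhdsWithin_le_nhds] with s hs hi hb
    refine (Multiset.eq_of_le_of_card_le ?_ ?_).symm
    · rw [SuperOp.eigenvaluesNear, Multiset.le_filter]
      refine ⟨hs, fun z hz => ?_⟩
      obtain ⟨x, hx, rfl⟩ := Multiset.mem_map.1 hz
      exact hi x hx
    · rw [hb, Multiset.card_map, hcard]
  · refine (Multiset.eq_of_le_of_card_le ?_ ?_).symm
    · rw [SuperOp.eigenvaluesNear, Multiset.le_filter]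
      refine ⟨?_, fun z hz => ?_⟩
      · rw [← Multiset.le_count_iff_replicate_le, Polynomial.count_roots, hcard]
      · rw [Multiset.eq_of_mem_replicate hz]
        exact Metric.mem_ball_self hr
    · rw [hball'.self_of_nhds, Multiset.card_replicate, hcard]

end EigenvalueBranches

/-! ### The main theorem -/

theorem theorem3 {H : Type*} [NormedAddCommGroup H] [InnerProductSpace ℂ H]
    [FiniteDimensional ℂ H] [CompleteSpace H]
    (L' : ℝ → SuperOp H) (hanalytic : AnalyticAt ℝ L' 0)
    (hgen : ∀ᶠ s in 𝓝 (0 : ℝ), IsCPTPGenerator (L' s))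
    (ω : ℝ)
    (hω : Module.End.HasEigenvalue (L' 0 : Op H →ₗ[ℂ] Op H) (Complex.I * ω)) :
    (∃ (ev : Fin ((SuperOp.charpoly (L' 0)).rootMultiplicity (Complex.I * ω)) → ℝ → ℂ)
        (r : ℝ), 0 < r ∧
      (∀ᶠ s in 𝓝 (0 : ℝ),
        SuperOp.eigenvaluesNear (L' s) (Complex.I * ω) r
          = Finset.univ.val.map fun j => ev j s) ∧
      ∀ j, HasStableExpansion (𝓝 0) ω (ev j)) ∧
    (∀ (δ : ℝ) (ev : ℝ → ℂ), 0 < δ → ContinuousOn ev (Set.Ico 0 δ) →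
      ev 0 = Complex.I * ω →
      (∀ s ∈ Set.Ico 0 δ, Module.End.HasEigenvalue (L' s : Op H →ₗ[ℂ] Op H) (ev s)) →
      HasStableExpansion (𝓝[≥] 0) ω ev) := by
  classical
  obtain ⟨F, P, r, hr, hcard, hne, hzero, hF⟩ := exists_eigenvalue_branches hanalytic hgen ω
  have hgt : 𝓝[>] (0 : ℝ) ≤ 𝓝[≠] 0 := nhdsWithin_mono _ fun s hs => ne_of_gt hs
  refine ⟨?_, fun δ ev hδ hcont hev0 hev => ?_⟩
  · obtain ⟨g, hg⟩ := Multiset.exists_eq_map_univ hcard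
    -- The expansions live on a punctured neighbourhood, so the value at `0` is imposed.
    refine ⟨fun j s => if s = 0 then Complex.I * ω else (g j).1 s, r, hr, ?_, fun j => ?_⟩
    · rw [eventually_nhdsWithin_iff] at hne
      filter_upwards [hne] with s hs
      by_cases hs0 : s = 0
      · subst hs0
        rw [hzero, hcard]
        simp
      · rw [hs hs0, hg, Multiset.map_map]
        simp [hs0]
    · obtain ⟨hp, hb, hexp⟩ := hF (g j) (hg ▸ Multiset.mem_map_of_mem g (Finset.mem_univ_val j))
      refine HasBranchExpansion.hasStableExpansion (a := (g j).2.1) (hexp.congr' ?_) hp hb (by simp)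
      filter_upwards [self_mem_nhdsWithin] with s hs
      have hs0 : s ≠ 0 := hs
      simp [hs0]
  · have hcont' : ContinuousOn ev (Set.Ioo 0 δ) := hcont.mono Set.Ioo_subset_Ico_self
    have hofReal : ContinuousOn (fun s : ℝ => (s : ℂ)) (Set.Ioo 0 δ) :=
      Complex.continuous_ofReal.continuousOn
    have hne0 : ∀ s ∈ Set.Ioo 0 δ, (s : ℂ) ≠ 0 := fun s hs => by exact_mod_cast hs.1.ne'
    have hmem : ∀ᶠ s in 𝓝[>] 0, ∃ x ∈ F.toFinset, ev s = x.1 s := by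
      have hlim : Tendsto ev (𝓝[>] 0) (𝓝 (Complex.I * ω)) := by
        rw [← hev0]
        refine (hcont 0 ⟨le_rfl, hδ⟩).tendsto.mono_left ?_
        rw [nhdsWithin_Ico_eq_nhdsGE hδ]
        exact nhdsWithin_mono _ Set.Ioi_subset_Ici_self
      filter_upwards [hne.filter_mono hgt, hlim.eventually (Metric.ball_mem_nhds _ hr),
        Ioo_mem_nhdsGT hδ] with s hs hball hsδ
      have h1 : ev s ∈ SuperOp.eigenvaluesNear (L' s) (Complex.I * ω) r := by
        rw [SuperOp.eigenvaluesNear, Multiset.mem_filter]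
        exact ⟨SuperOp.mem_roots_charpoly.2 (hev s ⟨hsδ.1.le, hsδ.2⟩), hball⟩
      rw [hs] at h1
      obtain ⟨x, hx, hxs⟩ := Multiset.mem_map.1 h1
      exact ⟨x, Multiset.mem_toFinset.2 hx, hxs.symm⟩
    -- First selection: the difference quotient of `ev` settles on one slope, and thereafter `ev`
    -- meets only branches with that slope.
    obtain ⟨x₁, -, -, hslope⟩ := exists_tendsto_of_continuousOn_of_forall_exists_eq F.toFinset
      (f := fun x s => (x.1 s - Complex.I * ω) / s) (c := fun x => Complex.I * x.2.1)
      (fun x hx => by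
        obtain ⟨hp, -, hexp⟩ := hF x (Multiset.mem_toFinset.1 hx)
        exact HasBranchExpansion.tendsto_div hgt hp (hexp.mono_left hgt))
      (g := fun s => (ev s - Complex.I * ω) / s) hδ
      ((hcont'.sub continuousOn_const).div hofReal hne0)
      (by
        filter_upwards [hmem] with s ⟨x, hx, hxs⟩
        exact ⟨x, hx, by rw [hxs]⟩)
    set a := x₁.2.1 with ha
    -- Second selection: with the common exponent `P a`, all branches of slope `a` are normalised by
    -- the same function, so the next coefficient is selected in the same way.
    obtain ⟨x₂, hx₂, hlim, -⟩ := exists_tendsto_of_continuousOn_of_forall_exists_eq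
      (F.toFinset.filter fun x => x.2.1 = a)
      (f := fun x s => (x.1 s - (Complex.I * ω + Complex.I * a * s)) /
        (s * (s : ℂ) ^ (1 / (P a : ℂ)))) (c := fun x => x.2.2)
      (fun x hx => by
        obtain ⟨hx, hxa⟩ := Finset.mem_filter.1 hx
        obtain ⟨-, -, hexp⟩ := hF x (Multiset.mem_toFinset.1 hx)
        rw [hxa] at hexp
        exact hexp.mono_left hgt)
      (g := fun s => (ev s - (Complex.I * ω + Complex.I * a * s)) /
        (s * (s : ℂ) ^ (1 / (P a : ℂ)))) hδ
      ((hcont'.sub (continuousOn_const.add (continuousOn_const.mul hofReal))).div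
        (hofReal.mul (hofReal.cpow_const fun s hs => .inl (by simpa using hs.1)))
        fun s hs => ofReal_mul_cpow_ne_zero _ hs.1.ne')
      (by
        filter_upwards [hslope, self_mem_nhdsWithin] with s ⟨x, hx, hxa, hxs⟩ hs
        have hs0 : (s : ℂ) ≠ 0 := by exact_mod_cast (ne_of_gt hs : s ≠ 0)
        refine ⟨x, Finset.mem_filter.2 ⟨hx, ?_⟩, ?_⟩
        · simpa using hxa
        · have : ev s = x.1 s := by
            rw [div_left_inj' hs0] at hxs
            exact sub_left_injective hxs
          rw [this])
    obtain ⟨hx₂, hx₂a⟩ := Finset.mem_filter.1 hx₂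
    obtain ⟨hp, hb, -⟩ := hF x₂ (Multiset.mem_toFinset.1 hx₂)
    rw [hx₂a] at hp
    refine HasBranchExpansion.hasStableExpansion (a := a) (b := x₂.2.2) (p := P a) ?_ hp hb hev0
    refine hlim.mono_left ?_
    rw [nhdsWithin, inf_assoc, inf_principal]
    exact nhdsWithin_mono _ fun s hs => lt_of_le_of_ne hs.1 (Ne.symm hs.2)
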